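/- Let $K \subset \mathbb{R}^n$ be a nonempty convex body, that is, a nonempty compact convex set, and let $\mathrm{dist}_K(x) = \min_{y \in K} \|y - x\|$ be the Euclidean distance from $x$ to $K$. Write $B^m$ for the closed Euclidean unit ball of $\mathbb{R}^m$, $\kappa_m = \mathrm{Vol}_m(B^m)$ for its volume and $\omega_m = m\kappa_m$ for its surface area. The intrinsic volumes $V_0(K), \dots, V_n(K)$ are the coefficients in Steiner's formula $$\mathrm{Vol}_n(K + \lambda B^n) = \sum_{i=0}^n \lambda^{n-i} \kappa_{n-i} V_i(K) \qquad \text{for all } \lambda \ge 0.$$ The rotation volumes and the total rotation volume of $K$ are $$\mathring{V}_i(K) = \frac{\omega_{n+1}}{\omega_{i+1}} V_{n-i}(K) \quad (0 \le i \le n), \qquad \mathring{W}(K) = \sum_{i=0}^n \mathring{V}_i(K),$$ and the central rotation volume of $K$ is the expectation of the random variable that takes the value $n - i$ with probability $\mathring{V}_i(K)/\mathring{W}(K)$: $$\mathring{\delta}(K) = \frac{1}{\mathring{W}(K)} \sum_{i=0}^n (n-i)\, \mathring{V}_i(K).$$ Then $$\mathring{W}(K) = \frac{\omega_{n+1}}{2}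 \int_{\mathbb{R}^n} e^{-2\pi\, \mathrm{dist}_K(x)}\, dx$$ and $$n - \mathring{\delta}(K) = \frac{\omega_{n+1}}{2 \mathring{W}(K)} \int_{\mathbb{R}^n} 2\pi\, \mathrm{dist}_K(x)\, e^{-2\pi\, \mathrm{dist}_K(x)}\, dx,$$ where both integrals converge. -/

import Mathlib

open scoped Pointwise

noncomputable section

/-- `κ_n`: the volume of the Euclidean unit ball of `ℝⁿ`. -/
def ballVolume (n : ℕ) : ℝ :=
  MeasureTheory.volume.real (Metric.closedBall (0 : EuclideanSpace ℝ (Fin n)) 1)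

/-- `ω_n = n κ_n`: the surface area of the Euclidean unit ball of `ℝⁿ`. -/
def sphereArea (n : ℕ) : ℝ := n * ballVolume n

/-- `V` is the sequence of coefficients in the Steiner formula
`Vol (K + t B) = ∑ i ≤ n, t ^ (n - i) κ_{n - i} V i` for all `t ≥ 0`,
extended by zero outside `0, …, n`. -/
def IsSteinerSequence {n : ℕ} (K : ConvexBody (EuclideanSpace ℝ (Fin n))) (V : ℕ → ℝ) : Prop :=
  (∀ i, n < i → V i = 0) ∧
  ∀ t : ℝ, 0 ≤ t →
    MeasureTheory.volume.real
        ((K : Set (EuclideanSpace ℝ (Fin n))) +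
          t • Metric.closedBall (0 : EuclideanSpace ℝ (Fin n)) 1) =
      ∑ i ∈ Finset.range (n + 1), t ^ (n - i) * ballVolume (n - i) * V i

theorem ballVolume_pos (n : ℕ) : 0 < ballVolume n := by
  unfold ballVolume MeasureTheory.Measure.real
  exact ENNReal.toReal_pos (Metric.measure_closedBall_pos _ _ one_pos).ne'
    MeasureTheory.measure_closedBall_lt_top.ne

/-- The Steiner formula determines its coefficients, so the choice made in
`intrinsicVolume` below is no choice at all. -/
theorem IsSteinerSequence.unique {n : ℕ} {K : ConvexBody (EuclideanSpace ℝ (Fin n))}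
    {V W : ℕ → ℝ} (hV : IsSteinerSequence K V) (hW : IsSteinerSequence K W) : V = W := by
  classical
  let P : (ℕ → ℝ) → Polynomial ℝ := fun U =>
    ∑ i ∈ Finset.range (n + 1), Polynomial.monomial (n - i) (ballVolume (n - i) * U i)
  have hP : ∀ U : ℕ → ℝ, ∀ t : ℝ, (P U).eval t =
      ∑ i ∈ Finset.range (n + 1), t ^ (n - i) * ballVolume (n - i) * U i := by
    intro U t
    simp only [P, Polynomial.eval_finsetSum, Polynomial.eval_monomial]
    exact Finset.sum_congr rfl fun i _ => by ring
  have hPeq : P V = P W := by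
    refine Polynomial.eq_of_infinite_eval_eq _ _ ((Set.Ici_infinite (0 : ℝ)).mono ?_)
    intro t ht
    show (P V).eval t = (P W).eval t
    rw [hP, hP, ← hV.2 t ht, ← hW.2 t ht]
  have hc : ∀ U : ℕ → ℝ, ∀ i, i ≤ n → (P U).coeff (n - i) = ballVolume (n - i) * U i := by
    intro U i hi
    simp only [P, Polynomial.finsetSum_coeff, Polynomial.coeff_monomial]
    rw [Finset.sum_eq_single i]
    · simp
    · intro j hj hji
      have := Finset.mem_range.1 hj
      rw [if_neg (by omega)]
    · intro h
      exact absurd (Finset.mem_range.2 (by omega)) h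
  funext i
  by_cases hi : i ≤ n
  · have h := hc V i hi
    rw [hPeq, hc W i hi] at h
    exact (mul_left_cancel₀ (ballVolume_pos _).ne' h).symm
  · rw [hV.1 i (by omega), hW.1 i (by omega)]

open Classical in
/-- The intrinsic volume `V_i(K)`: the `i`-th coefficient in the Steiner formula of `K`. -/
def intrinsicVolume {n : ℕ} (K : ConvexBody (EuclideanSpace ℝ (Fin n))) (i : ℕ) : ℝ :=
  if h : ∃ V : ℕ → ℝ, IsSteinerSequence K V then h.choose i else 0

/-- The rotation volume of index `i`, meant for `0 ≤ i ≤ n`. -/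
def rotationVolume {n : ℕ} (K : ConvexBody (EuclideanSpace ℝ (Fin n))) (i : ℕ) : ℝ :=
  sphereArea (n + 1) / sphereArea (i + 1) * intrinsicVolume K (n - i)

/-- The total rotation volume. -/
def totalRotationVolume {n : ℕ} (K : ConvexBody (EuclideanSpace ℝ (Fin n))) : ℝ :=
  ∑ i ∈ Finset.range (n + 1), rotationVolume K i

/-- The central rotation volume: the expectation of the random variable that takes the value
`n - i` with probability `rotationVolume K i / totalRotationVolume K`, for `0 ≤ i ≤ n`. -/
def centralRotationVolume {n : ℕ} (K : ConvexBody (EuclideanSpace ℝ (Fin n))) : ℝ :=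
  ∑ i ∈ Finset.range (n + 1),
    ((n : ℝ) - (i : ℝ)) * (rotationVolume K i / totalRotationVolume K)

end

/-! Integrate Steiner's formula against an exponential. The set {dist_K ≤ t} is K + tB, so by Fubini
the integral of φ(dist_K), where φ(a) = ∫_a^∞ h, equals ∑_j κ_j V_{n-j}(K) ∫_0^∞ t^j h(t) dt. For
φ(a) = e^{-ba} the moments are j!/b^j; for φ(a) = ba e^{-ba} they are j·j!/b^j. The identity ω_{j+1}
κ_j j! = 2(2π)^j (`sphereArea_succ_mul_ballVolume`) makes the j-th term at b = 2π equal to 2/ω_{n+1}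
times the j-th rotation volume, so the two sums give the total and, after normalization, the mean
index.

Since `intrinsicVolume` is 0 by default, Steiner's formula itself is needed
(`exists_polynomial_measureReal_cthickening`). Vol(K + t[0,v]) is affine in t, hence Vol(K + tZ) is
polynomial for a zonotope Z. The ball is a limit of zonotopes, and polynomials of bounded degree are
closed under pointwise limits. -/

open MeasureTheory Metric Filter Topology

/-! ### Sums with segments -/

section SegmentSums

variable {E : Type*} [NormedAddCommGroup E] [NormedSpace ℝ E]

theorem mem_add_smul_segment_zero_iff {K : Set E} {v x : E} {t : ℝ} (ht : 0 ≤ t) :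
    x ∈ K + t • segment ℝ 0 v ↔ ∃ k ∈ K, ∃ r : ℝ, 0 ≤ r ∧ r ≤ t ∧ k + r • v = x := by
  constructor
  · rintro ⟨k, hk, _, ⟨y, hy, rfl⟩, rfl⟩
    rw [segment_eq_image] at hy
    obtain ⟨θ, ⟨h0, h1⟩, rfl⟩ := hy
    refine ⟨k, hk, t * θ, by positivity, mul_le_of_le_one_right ht h1, ?_⟩
    simp [mul_smul]
  · rintro ⟨k, hk, r, h0, h1, rfl⟩
    rcases ht.eq_or_lt with rfl | ht'
    · obtain rfl : r = 0 := le_antisymm h1 h0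
      exact ⟨k, hk, _, ⟨0, left_mem_segment ℝ 0 v, rfl⟩, by simp⟩
    · refine ⟨k, hk, _, ⟨(r / t) • v, ?_, rfl⟩, ?_⟩
      · rw [segment_eq_image]
        exact ⟨r / t, ⟨by positivity, (div_le_one ht').2 h1⟩, by simp⟩
      · simp only [smul_smul, mul_div_cancel₀ _ ht'.ne']

/-- Growing along v adds layers that are translates of each other; this makes the volume increment
additive. Convexity enters because a point k + r v that is also k' - (s - r') v lies between k and
k'. -/
theorem add_smul_segment_zero_diff {K : Set E} (hK : Convex ℝ K) (v : E) {s t : ℝ}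
    (hs : 0 ≤ s) (ht : 0 ≤ t) :
    (K + (s + t) • segment ℝ 0 v) \ (K + s • segment ℝ 0 v) =
      (s • v) +ᵥ ((K + t • segment ℝ 0 v) \ K) := by
  ext x
  rw [Set.mem_vadd_set_iff_neg_vadd_mem, Set.mem_sdiff, Set.mem_sdiff,
    mem_add_smul_segment_zero_iff hs, mem_add_smul_segment_zero_iff ht,
    mem_add_smul_segment_zero_iff (add_nonneg hs ht)]
  simp only [vadd_eq_add]
  constructor
  · rintro ⟨⟨k, hk, r, h0, h1, rfl⟩, hx⟩
    have hr : s < r := by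
      by_contra! h
      exact hx ⟨k, hk, r, h0, h, rfl⟩
    refine ⟨⟨k, hk, r - s, by linarith, by linarith, by module⟩, fun hmem => ?_⟩
    exact hx ⟨_, hmem, s, hs, le_rfl, by module⟩
  · rintro ⟨⟨k, hk, r, h0, h1, hx⟩, hxK⟩
    have hx' : x = k + (s + r) • v := by
      rw [add_smul, add_left_comm, hx]
      abel
    refine ⟨⟨k, hk, s + r, by linarith, by linarith, hx'.symm⟩, ?_⟩
    rintro ⟨k', hk', r', h0', h1', rfl⟩
    apply hxK
    -- the point lies on a segment with both end points in `K`
    rcases (add_nonneg h0 (sub_nonneg.2 h1')).eq_or_lt with h | h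
    · obtain rfl : r = 0 := by linarith
      rw [zero_smul, add_zero] at hx
      rwa [← hx]
    · have hd : k' = k + (s + r - r') • v := by
        rw [eq_sub_of_add_eq hx']; module
      have : -(s • v) + (k' + r' • v) = (r / (r + (s - r'))) • k' +
          ((s - r') / (r + (s - r'))) • k := by
        rw [hd]
        have e1 : (r / (r + (s - r'))) + ((s - r') / (r + (s - r'))) = 1 := by
          field_simp
        have e2 : (r / (r + (s - r'))) * (s + r - r') = r := by
          field_simp; ring
        calc _ = k + r • v := by module
          _ = ((r / (r + (s - r'))) + ((s - r') / (r + (s - r')))) • k +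
              ((r / (r + (s - r'))) * (s + r - r')) • v := by rw [e1, e2, one_smul]
          _ = _ := by module
      rw [this]
      exact hK hk' hk (by positivity) (div_nonneg (by linarith) h.le) (by field_simp)

theorem segment_isCompact (a b : E) : IsCompact (segment ℝ a b) := by
  rw [segment_eq_image]
  exact isCompact_Icc.image (by fun_prop)

theorem isCompact_sum_segment {ι : Type*} (s : Finset ι) (v : ι → E) :
    IsCompact (∑ i ∈ s, segment ℝ 0 (v i)) := by
  classical
  induction s using Finset.induction_on with
  | empty => simp
  | insert i s hi ih =>
    rw [Finset.sum_insert hi]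
    exact (segment_isCompact _ _).add ih

theorem convex_sum_segment {ι : Type*} (s : Finset ι) (v : ι → E) :
    Convex ℝ (∑ i ∈ s, segment ℝ 0 (v i)) :=
  convex_sum _ fun _ _ => convex_segment _ _

end SegmentSums

/-! ### Volume of K plus a scaled zonotope -/

/-- The monotone solutions of Cauchy's functional equation on the nonnegative reals are linear. -/
theorem eq_mul_of_add_of_monotoneOn {g : ℝ → ℝ}
    (hadd : ∀ s t, 0 ≤ s → 0 ≤ t → g (s + t) = g s + g t)
    (hmono : ∀ s t, 0 ≤ s → s ≤ t → g s ≤ g t) {t : ℝ} (ht : 0 ≤ t) : g t = t * g 1 := by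
  have hg0 : g 0 = 0 := by simpa using hadd 0 0 le_rfl le_rfl
  have hnat : ∀ (N : ℕ) (x : ℝ), 0 ≤ x → g (N * x) = N * g x := by
    intro N x hx
    induction N with
    | zero => simp [hg0]
    | succ N ih =>
      rw [Nat.cast_succ, add_mul, one_mul, hadd _ _ (by positivity) hx, ih]; ring
  have hg1 : 0 ≤ g 1 := hg0 ▸ hmono 0 1 le_rfl zero_le_one
  -- Squeezing N t between consecutive integers bounds N times the error independently of N.
  have key : ∀ N : ℕ, N * |g t - t * g 1| ≤ g 1 := by
    intro N
    have hNt : 0 ≤ N * t := by positivity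
    have h1 := hmono _ _ (Nat.cast_nonneg _) (Nat.floor_le hNt)
    have h2 := hmono _ _ hNt (Nat.lt_floor_add_one (N * t)).le
    have h3 := hnat ⌊N * t⌋₊ 1 zero_le_one
    have h4 := hnat (⌊N * t⌋₊ + 1) 1 zero_le_one
    rw [mul_one] at h3 h4
    rw [h3, hnat N t ht] at h1
    push_cast at h4
    rw [h4, hnat N t ht] at h2
    have h5 := mul_le_mul_of_nonneg_right (Nat.floor_le hNt) hg1
    have h6 := mul_le_mul_of_nonneg_right (Nat.lt_floor_add_one (N * t)).le hg1
    rw [← abs_of_nonneg (Nat.cast_nonneg (α := ℝ) N), ← abs_mul, abs_le]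
    constructor <;> nlinarith
  by_contra hne
  have hpos : 0 < |g t - t * g 1| := abs_pos.2 (sub_ne_zero.2 hne)
  obtain ⟨N, hN⟩ := exists_nat_gt (g 1 / |g t - t * g 1|)
  exact absurd (key N) (not_le.2 ((div_lt_iff₀ hpos).1 hN))

section SegmentVolume

variable {E : Type*} [NormedAddCommGroup E] [NormedSpace ℝ E]
  [MeasurableSpace E] [BorelSpace E] (μ : Measure E) [μ.IsAddHaarMeasure]

/-- The volume of `K + t [0, v]` is an affine function of `t ≥ 0`. -/
theorem measureReal_add_smul_segment {K : Set E} (hK : Convex ℝ K) (hKc : IsCompact K) (v : E)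
    {t : ℝ} (ht : 0 ≤ t) :
    μ.real (K + t • segment ℝ 0 v) =
      μ.real K + t * (μ.real (K + segment ℝ 0 v) - μ.real K) := by
  have hc : ∀ t : ℝ, IsCompact (K + t • segment ℝ 0 v) := fun t =>
    hKc.add ((segment_isCompact 0 v).smul t)
  have hmono : ∀ s t : ℝ, 0 ≤ s → s ≤ t → K + s • segment ℝ 0 v ⊆ K + t • segment ℝ 0 v := by
    intro s t hs hst x
    rw [mem_add_smul_segment_zero_iff hs, mem_add_smul_segment_zero_iff (hs.trans hst)]
    rintro ⟨k, hk, r, h0, h1, h⟩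
    exact ⟨k, hk, r, h0, h1.trans hst, h⟩
  have hzero : K + (0 : ℝ) • segment ℝ 0 v = K := by
    rw [Set.zero_smul_set ⟨0, left_mem_segment ℝ 0 v⟩, add_zero]
  have hdiff : ∀ s t : ℝ, 0 ≤ s → s ≤ t →
      μ.real ((K + t • segment ℝ 0 v) \ (K + s • segment ℝ 0 v)) =
        μ.real (K + t • segment ℝ 0 v) - μ.real (K + s • segment ℝ 0 v) := fun s t hs hst =>
    measureReal_sdiff (hmono s t hs hst) (hc s).measurableSet (hc t).measure_lt_top.ne
  have hg := eq_mul_of_add_of_monotoneOn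
    (g := fun t => μ.real (K + t • segment ℝ 0 v) - μ.real K) ?_ ?_ ht
  · simp only [one_smul] at hg
    linarith
  · intro s t hs ht
    have h1 := hdiff s (s + t) hs (by linarith)
    have h2 := hdiff 0 t le_rfl ht
    rw [hzero] at h2
    rw [add_smul_segment_zero_diff hK v hs ht, measureReal_def, measure_vadd,
      ← measureReal_def, h2] at h1
    linarith
  · intro s t hs hst
    exact sub_le_sub_right (measureReal_mono (hmono s t hs hst) (hc t).measure_lt_top.ne) _

/-- The volume of `K + t Z`, for a zonotope `Z`, is a polynomial in `t ≥ 0`. -/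
theorem exists_polynomial_measureReal_add_smul_sum_segment {ι : Type*} (s : Finset ι) (v : ι → E)
    {K : Set E} (hK : Convex ℝ K) (hKc : IsCompact K) :
    ∃ p : Polynomial ℝ, ∀ t : ℝ, 0 ≤ t →
      μ.real (K + t • ∑ i ∈ s, segment ℝ 0 (v i)) = p.eval t := by
  classical
  induction s using Finset.induction_on generalizing K with
  | empty => exact ⟨Polynomial.C (μ.real K), fun t _ => by simp⟩
  | insert i s hi ih =>
    obtain ⟨p, hp⟩ := ih hK hKc
    obtain ⟨q, hq⟩ := ih (hK.add (convex_segment 0 (v i))) (hKc.add (segment_isCompact 0 (v i)))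
    -- With tZ' fixed, the volume is affine in the multiple of the new segment, with values p(t) at
    -- 0 and q(t) at t; the latter is not the value at 1, so affinity is used for the body K + tZ'
    -- via its unit increment.
    refine ⟨p + Polynomial.X * (q - p), fun t ht => ?_⟩
    rw [Finset.sum_insert hi, smul_add, ← add_assoc, add_right_comm,
      measureReal_add_smul_segment μ (hK.add ((convex_sum_segment s v).smul t))
        (hKc.add ((isCompact_sum_segment s v).smul t)) _ ht,
      add_right_comm K, hp t ht, hq t ht]
    simp

end SegmentVolume

/-! ### Zonotopes approximating the ball -/

section BallZonotope

variable {E : Type*} [NormedAddCommGroup E] [InnerProductSpace ℝ E]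

/-- With `exists_mem_sum_segment_inner_eq`, this computes the support function of a zonotope. -/
theorem inner_le_of_mem_sum_segment {ι : Type*} {s : Finset ι} {v : ι → E} {z : E}
    (hz : z ∈ ∑ i ∈ s, segment ℝ 0 (v i)) (u : E) :
    inner ℝ u z ≤ ∑ i ∈ s, max 0 (inner ℝ u (v i)) := by
  obtain ⟨g, hg, rfl⟩ := (Set.mem_finsetSum _ _ _).1 hz
  rw [inner_sum]
  refine Finset.sum_le_sum fun i hi => ?_
  have h := hg hi
  rw [segment_eq_image] at h
  obtain ⟨θ, ⟨h0, h1⟩, h⟩ := h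
  rw [← h]
  simp only [smul_zero, zero_add, inner_smul_right]
  calc θ * inner ℝ u (v i) ≤ θ * max 0 (inner ℝ u (v i)) :=
        mul_le_mul_of_nonneg_left (le_max_right _ _) h0
    _ ≤ max 0 (inner ℝ u (v i)) := mul_le_of_le_one_left (le_max_left _ _) h1

theorem exists_mem_sum_segment_inner_eq {ι : Type*} (s : Finset ι) (v : ι → E) (u : E) :
    ∃ z ∈ ∑ i ∈ s, segment ℝ 0 (v i), inner ℝ u z = ∑ i ∈ s, max 0 (inner ℝ u (v i)) := by
  classical
  refine ⟨∑ i ∈ s, if 0 ≤ inner ℝ u (v i) then v i else 0,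
    Set.finsetSum_mem_finsetSum _ _ _ fun i _ => ?_, ?_⟩
  · split_ifs
    exacts [right_mem_segment _ _ _, left_mem_segment _ _ _]
  · rw [inner_sum]
    refine Finset.sum_congr rfl fun i _ => ?_
    split_ifs with h
    · rw [max_eq_right h]
    · rw [max_eq_left (not_le.1 h).le, inner_zero_right]

theorem sum_segment_subset_closedBall {ι : Type*} (s : Finset ι) (v : ι → E) {r : ℝ} (hr : 0 ≤ r)
    (h : ∀ u : E, ∑ i ∈ s, max 0 (inner ℝ u (v i)) ≤ r * ‖u‖) :
    ∑ i ∈ s, segment ℝ 0 (v i) ⊆ closedBall 0 r := by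
  intro z hz
  rw [mem_closedBall_zero_iff]
  have h1 := (inner_le_of_mem_sum_segment hz z).trans (h z)
  rw [real_inner_self_eq_norm_mul_norm] at h1
  rcases (norm_nonneg z).eq_or_lt with h0 | h0
  · rwa [← h0]
  · exact le_of_mul_le_mul_right h1 h0

variable [FiniteDimensional ℝ E]

/-- Bounds on the support function of a zonotope translate into inclusions. -/
theorem closedBall_subset_sum_segment {ι : Type*} (s : Finset ι) (v : ι → E)
    (h : ∀ u : E, ‖u‖ ≤ ∑ i ∈ s, max 0 (inner ℝ u (v i))) :
    closedBall 0 1 ⊆ ∑ i ∈ s, segment ℝ 0 (v i) := by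
  intro x hx
  by_contra hxZ
  obtain ⟨f, a, hf, ha⟩ := geometric_hahn_banach_closed_point (convex_sum_segment s v)
    (isCompact_sum_segment s v).isClosed hxZ
  set u := (InnerProductSpace.toDual ℝ E).symm f with hu
  have hfu : ∀ y, f y = inner ℝ u y := fun y => by
    rw [hu, InnerProductSpace.toDual_symm_apply]
  obtain ⟨z, hz, hzu⟩ := exists_mem_sum_segment_inner_eq s v u
  have h1 := hf z hz
  rw [hfu, hzu] at h1
  rw [hfu] at ha
  have h2 := real_inner_le_norm u x
  have h3 : ‖u‖ * ‖x‖ ≤ ‖u‖ :=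
    mul_le_of_le_one_right (norm_nonneg _) (mem_closedBall_zero_iff.1 hx)
  linarith [h u]

variable [MeasurableSpace E] [BorelSpace E]

theorem integrableOn_max_inner_ball (u : E) :
    IntegrableOn (fun v : E => max 0 (inner ℝ u v)) (ball 0 1) := by
  have hc : Continuous fun v : E => max 0 (inner ℝ u v) := by fun_prop
  exact (hc.continuousOn.integrableOn_compact (isCompact_closedBall 0 1)).mono_set
    ball_subset_closedBall

/-- The reflection taking u to w preserves both the ball and the volume. -/
theorem integral_max_inner_ball_eq_of_norm_eq {u w : E} (h : ‖u‖ = ‖w‖) :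
    ∫ v in ball (0 : E) 1, max 0 (inner ℝ u v) = ∫ v in ball (0 : E) 1, max 0 (inner ℝ w v) := by
  set R := (ℝ ∙ (u - w))ᗮ.reflection
  have hR : R u = w := Submodule.reflection_sub h
  have := R.measurePreserving.setIntegral_preimage_emb R.toHomeomorph.measurableEmbedding
    (fun v => max 0 (inner ℝ w v)) (ball 0 1)
  rw [← this, ← hR]
  simp [R.preimage_ball]

/-- The average of the support functions of the segments [0, v] is rotation invariant and positively
homogeneous, hence a multiple of the norm, the support function of the unit ball. -/
theorem exists_integral_max_inner_ball_eq :
    ∃ c : ℝ, 0 < c ∧ ∀ u : E, ∫ v in ball (0 : E) 1, max 0 (inner ℝ u v) = c * ‖u‖ := by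
  rcases subsingleton_or_nontrivial E with hE | hE
  · exact ⟨1, one_pos, fun u => by simp [Subsingleton.elim u 0]⟩
  obtain ⟨e, he⟩ := exists_norm_eq E zero_le_one
  refine ⟨∫ v in ball (0 : E) 1, max 0 (inner ℝ e v), ?_, fun u => ?_⟩
  · rw [setIntegral_pos_iff_support_of_nonneg_ae 
      (f := fun v => max 0 (inner ℝ e v)) (.of_forall fun v => le_max_left _ _)
      (integrableOn_max_inner_ball e)]
    have hc : Continuous fun v : E => max 0 (inner ℝ e v) := by fun_prop
    refine (hc.isOpen_support.inter isOpen_ball).measure_pos _ ⟨(1 / 2 : ℝ) • e, ?_, ?_⟩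
    · simp [inner_smul_right, he]
    · simp [norm_smul, he]; norm_num
  · rw [integral_max_inner_ball_eq_of_norm_eq (w := ‖u‖ • e) (by simp [norm_smul, he]),
      mul_comm, ← integral_const_mul]
    congr 1 with v
    rw [inner_smul_left, mul_max_of_nonneg _ _ (norm_nonneg u)]
    simp

theorem exists_sum_max_inner_bounds {ε : ℝ} (hε : 0 < ε) :
    ∃ (s : Finset E) (v : E → E), ∀ u : E,
      ‖u‖ ≤ ∑ i ∈ s, max 0 (inner ℝ u (v i)) ∧
      ∑ i ∈ s, max 0 (inner ℝ u (v i)) ≤ (1 + ε) * ‖u‖ := by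
  obtain ⟨c, hc, hcu⟩ := exists_integral_max_inner_ball_eq (E := E)
  set μ : Measure E := volume.restrict (ball 0 1) with hμ
  -- Chosen so that (c + η) / (c - η) = 1 + ε.
  set η : ℝ := c * ε / (2 + ε) with hη
  have hη0 : 0 < η := by positivity
  have hηc : η * (2 + ε) = c * ε := by rw [hη]; field_simp
  have hcη : 0 < c - η := by
    have : 0 < (c - η) * (2 + ε) := by nlinarith
    exact pos_of_mul_pos_left this (by positivity)
  have hid : Integrable (fun v : E => v) μ :=
    (continuous_id.continuousOn.integrableOn_compact (isCompact_closedBall (0 : E) 1)).mono_set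
      ball_subset_closedBall
  -- A simple function close to the identity in L¹ turns the average into a finite sum, with error
  -- at most η‖u‖ for all u at once.
  obtain ⟨g, hg, hgm⟩ := (memLp_one_iff_integrable.2 hid).exists_simpleFunc_eLpNorm_sub_lt
    ENNReal.one_ne_top (ENNReal.ofReal_pos.2 hη0).ne'
  have hgi : Integrable g μ := memLp_one_iff_integrable.1 hgm
  have hdist : ∫ x, ‖x - g x‖ ∂μ ≤ η := by
    rw [integral_norm_eq_lintegral_enorm (f := fun x => x - g x)
      (hid.sub hgi).aestronglyMeasurable]
    rw [eLpNorm_one_eq_lintegral_enorm] at hg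
    exact ENNReal.toReal_le_of_le_ofReal hη0.le hg.le
  have hgu : ∀ u : E, Integrable (fun x => max 0 (inner ℝ u (g x))) μ := fun u =>
    (integrable_zero E ℝ μ).sup (hgi.const_inner u)
  have hsum : ∀ u : E, ∫ x, max 0 (inner ℝ u (g x)) ∂μ =
      ∑ y ∈ g.range, μ.real (g ⁻¹' {y}) * max 0 (inner ℝ u y) := by
    intro u
    have h := g.map_integral (fun y => max 0 (inner ℝ u y)) hgi (by simp)
    rw [SimpleFunc.integral_eq_integral] at h
    · simpa using h
    · exact hgu u
  have hclose : ∀ u : E, |∫ x, max 0 (inner ℝ u (g x)) ∂μ - c * ‖u‖| ≤ η * ‖u‖ := by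
    intro u
    have hi2 := integrableOn_max_inner_ball u
    rw [← hcu u, ← integral_sub (hgu u) hi2]
    calc _ ≤ ∫ x, |max 0 (inner ℝ u (g x)) - max 0 (inner ℝ u x)| ∂μ := abs_integral_le_integral_abs
      _ ≤ ∫ x, ‖u‖ * ‖x - g x‖ ∂μ := by
        refine integral_mono ((hgu u).sub hi2).abs ((hid.sub hgi).norm.const_mul _) fun x => ?_
        show |max 0 (inner ℝ u (g x)) - max 0 (inner ℝ u x)| ≤ ‖u‖ * ‖x - g x‖
        rw [max_comm 0, max_comm 0]
        refine (abs_max_sub_max_le_abs _ _ _).trans ?_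
        rw [← inner_sub_right, norm_sub_rev]
        exact abs_real_inner_le_norm _ _
      _ ≤ η * ‖u‖ := by
        rw [integral_const_mul, mul_comm]
        exact mul_le_mul_of_nonneg_right hdist (norm_nonneg u)
  refine ⟨g.range, fun y => ((c - η)⁻¹ * μ.real (g ⁻¹' {y})) • y, fun u => ?_⟩
  have hS : ∑ y ∈ g.range, max 0 (inner ℝ u (((c - η)⁻¹ * μ.real (g ⁻¹' {y})) • y)) =
      (c - η)⁻¹ * ∫ x, max 0 (inner ℝ u (g x)) ∂μ := by
    rw [hsum, Finset.mul_sum]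
    refine Finset.sum_congr rfl fun y _ => ?_
    rw [inner_smul_right, ← mul_assoc, mul_max_of_nonneg _ _ (by positivity), mul_zero]
  rw [hS]
  obtain ⟨h1, h2⟩ := abs_le.1 (hclose u)
  have hu := norm_nonneg u
  constructor
  · rw [le_inv_mul_iff₀ hcη]; linarith
  · rw [inv_mul_le_iff₀ hcη]
    have : c + η = (c - η) * (1 + ε) := by linarith
    rw [← mul_assoc, ← this]
    linarith

/-- The unit ball is approximated from outside by zonotopes. -/
theorem exists_sum_segment_near_closedBall {ε : ℝ} (hε : 0 < ε) :
    ∃ (s : Finset E) (v : E → E), closedBall 0 1 ⊆ ∑ i ∈ s, segment ℝ 0 (v i) ∧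
      ∑ i ∈ s, segment ℝ 0 (v i) ⊆ closedBall 0 (1 + ε) := by
  obtain ⟨s, v, h⟩ := exists_sum_max_inner_bounds (E := E) hε
  exact ⟨s, v, closedBall_subset_sum_segment s v fun u => (h u).1,
    sum_segment_subset_closedBall s v (by positivity) fun u => (h u).2⟩

end BallZonotope

/-! ### Growth and limits of polynomials -/

theorem natDegree_le_of_eval_le {p q : Polynomial ℝ} (hq : q ≠ 0)
    (h : ∀ t : ℝ, 0 ≤ t → 0 ≤ p.eval t ∧ p.eval t ≤ q.eval t) : p.natDegree ≤ q.natDegree := by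
  by_contra! hlt
  have ht := Polynomial.abs_div_tendsto_atTop_atTop_of_degree_gt p q
    (Polynomial.degree_lt_degree hlt) hq
  obtain ⟨t, ht1, ht0⟩ := ((ht.eventually_gt_atTop 1).and (eventually_ge_atTop 0)).exists
  obtain ⟨h0, h1⟩ := h t ht0
  rw [abs_of_nonneg (div_nonneg h0 (h0.trans h1))] at ht1
  exact absurd ht1 (not_lt.2 (div_le_one_of_le₀ h1 (h0.trans h1)))

/-- A pointwise limit on `[0, ∞)` of polynomials of degree at most `d` is such a polynomial. -/
theorem exists_polynomial_of_tendsto_eval {d : ℕ} {p : ℕ → Polynomial ℝ}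
    (hp : ∀ k, (p k).natDegree ≤ d) {f : ℝ → ℝ}
    (hf : ∀ t : ℝ, 0 ≤ t → Tendsto (fun k => (p k).eval t) atTop (𝓝 (f t))) :
    ∃ q : Polynomial ℝ, q.natDegree ≤ d ∧ ∀ t : ℝ, 0 ≤ t → f t = q.eval t := by
  classical
  set s := Finset.range (d + 1)
  have hinj : Set.InjOn (fun i : ℕ => (i : ℝ)) s := Nat.cast_injective.injOn
  refine ⟨Lagrange.interpolate s (fun i : ℕ => (i : ℝ)) fun i => f i, ?_, fun t ht => ?_⟩
  · have h := Lagrange.degree_interpolate_lt (fun i : ℕ => f i) hinj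
    rw [Finset.card_range] at h
    exact Polynomial.natDegree_le_iff_coeff_eq_zero.2
      ((Polynomial.degree_lt_iff_coeff_zero _ _).1 h)
  · refine tendsto_nhds_unique (hf t ht) ?_
    -- The value at t is a fixed linear combination of the values at the nodes 0, …, d, where
    -- convergence is known.
    have heq : ∀ k, (p k).eval t =
        ∑ i ∈ s, (p k).eval (i : ℝ) * (Lagrange.basis s (fun i : ℕ => (i : ℝ)) i).eval t := by
      intro k
      have hdeg : (p k).degree < s.card := by
        rw [Finset.card_range]
        exact (Polynomial.degree_le_of_natDegree_le (hp k)).trans_lt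
          (by exact_mod_cast Nat.lt_succ_self d)
      conv_lhs => rw [Lagrange.eq_interpolate hinj hdeg, Lagrange.interpolate_apply]
      simp [Polynomial.eval_finsetSum]
    simp only [heq, Lagrange.interpolate_apply, Polynomial.eval_finsetSum, Polynomial.eval_mul,
      Polynomial.eval_C]
    exact tendsto_finsetSum _ fun i _ => (hf i (Nat.cast_nonneg i)).mul_const _

/-! ### Steiner's formula -/

section Steiner

variable {E : Type*} [NormedAddCommGroup E] [InnerProductSpace ℝ E] [FiniteDimensional ℝ E]
  [MeasurableSpace E] [BorelSpace E]

/-- The volume of a parallel body is right-continuous in the radius. -/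
theorem tendsto_measureReal_cthickening_add {K : Set E} (hK : IsCompact K) {t : ℝ} (ht : 0 ≤ t)
    {r : ℕ → ℝ} (hr0 : ∀ k, 0 ≤ r k) (hr : Tendsto r atTop (𝓝 0)) :
    Tendsto (fun k => volume.real (cthickening (t + r k) K)) atTop
      (𝓝 (volume.real (cthickening t K))) := by
  have hc : IsCompact (cthickening t K) := hK.cthickening
  have h := (ENNReal.tendsto_toReal hc.measure_lt_top.ne).comp
    ((tendsto_measure_cthickening_of_isCompact (μ := volume) hc).comp hr)
  refine h.congr fun k => ?_
  simp only [Function.comp, measureReal_def, cthickening_cthickening (hr0 k) ht, add_comm t]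

/-- Steiner's formula: the volume of the parallel body of radius `t ≥ 0` of a compact convex set
is a polynomial in `t`. -/
theorem exists_polynomial_measureReal_cthickening {K : Set E} (hK : Convex ℝ K)
    (hKc : IsCompact K) :
    ∃ p : Polynomial ℝ, p.natDegree ≤ Module.finrank ℝ E ∧
      ∀ t : ℝ, 0 ≤ t → volume.real (cthickening t K) = p.eval t := by
  have hε : ∀ k : ℕ, (0 : ℝ) < 1 / ((k : ℝ) + 1) := fun k => Nat.one_div_pos_of_nat
  choose s v hZ1 hZ2 using fun k => exists_sum_segment_near_closedBall (E := E) (hε k)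
  choose p hp using fun k =>
    exists_polynomial_measureReal_add_smul_sum_segment volume (s k) (v k) hK hKc
  have hcomp : ∀ k (t : ℝ), IsCompact (K + t • ∑ i ∈ s k, segment ℝ 0 (v k i)) := fun k t =>
    hKc.add ((isCompact_sum_segment _ _).smul t)
  have hlow : ∀ k t, 0 ≤ t → volume.real (cthickening t K) ≤ (p k).eval t := by
    intro k t ht
    rw [← hp k t ht, ← hKc.add_closedBall_zero ht, ← smul_unitClosedBall_of_nonneg ht]
    exact measureReal_mono (Set.add_subset_add_left (Set.smul_set_mono (hZ1 k)))
      (hcomp k t).measure_lt_top.ne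
  have hup : ∀ k t, 0 ≤ t →
      (p k).eval t ≤ volume.real (cthickening (t + t * (1 / ((k : ℝ) + 1))) K) := by
    intro k t ht
    have hk := hε k
    rw [← hp k t ht, ← hKc.add_closedBall_zero (by positivity)]
    refine measureReal_mono (Set.add_subset_add_left ?_)
      (hKc.add (isCompact_closedBall _ _)).measure_lt_top.ne
    refine (Set.smul_set_mono (hZ2 k)).trans ?_
    rw [_root_.smul_closedBall _ _ (by positivity), smul_zero, Real.norm_of_nonneg ht, mul_add, mul_one]
  refine exists_polynomial_of_tendsto_eval (p := p) (fun k => ?_) fun t ht => ?_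
  -- The number of segments gives no uniform degree bound, but growth does: K lies in a ball of
  -- radius R and t + t/(k+1) ≤ 2t, so the volume is at most κ(R + 2t)^d.
  · obtain ⟨R, hR, hKR⟩ := hKc.isBounded.subset_closedBall_lt 0 (0 : E)
    set κ := volume.real (ball (0 : E) 1) with hκ
    have hκ0 : 0 < κ := 
      ENNReal.toReal_pos (measure_ball_pos volume _ one_pos).ne' measure_ball_lt_top.ne
    set d := Module.finrank ℝ E
    set q : Polynomial ℝ := Polynomial.C κ * (Polynomial.C R + Polynomial.C 2 * Polynomial.X) ^ d
      with hq
    have hqe : ∀ t, q.eval t = κ * (R + 2 * t) ^ d := fun t => by simp [hq]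
    have hq0 : q ≠ 0 := by
      intro h0
      have h := hqe 0
      rw [h0, Polynomial.eval_zero] at h
      have : 0 < κ * (R + 2 * 0) ^ d := by positivity
      exact this.ne h
    have hqd : q.natDegree ≤ d := by
      rw [hq]
      compute_degree
    refine (natDegree_le_of_eval_le hq0 fun t ht => ?_).trans hqd
    refine ⟨(hp k t ht) ▸ measureReal_nonneg, (hup k t ht).trans ?_⟩
    have h1 : t * (1 / ((k : ℝ) + 1)) ≤ t :=
      mul_le_of_le_one_right ht (div_le_one_of_le₀ (by simp) (by positivity))
    rw [hqe, mul_comm κ, add_comm R, ← Measure.addHaar_real_closedBall volume (0 : E)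
      (by positivity : 0 ≤ 2 * t + R), ← cthickening_closedBall (by positivity) hR.le]
    refine measureReal_mono ((cthickening_mono (by linarith) _).trans
      (cthickening_subset_of_subset _ hKR)) ?_
    rw [cthickening_closedBall (by positivity) hR.le]
    exact measure_closedBall_lt_top.ne
  · refine tendsto_of_tendsto_of_tendsto_of_le_of_le tendsto_const_nhds
      (tendsto_measureReal_cthickening_add hKc ht
        (r := fun k => t * (1 / ((k : ℝ) + 1))) (fun k => by have := hε k; positivity) ?_)
      (fun k => hlow k t ht) (fun k => hup k t ht)
    simpa using tendsto_one_div_add_atTop_nhds_zero_nat.const_mul t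

end Steiner

theorem exists_isSteinerSequence {n : ℕ} (K : ConvexBody (EuclideanSpace ℝ (Fin n))) :
    ∃ V : ℕ → ℝ, IsSteinerSequence K V := by
  obtain ⟨p, hpd, hp⟩ := exists_polynomial_measureReal_cthickening K.convex K.isCompact
  rw [finrank_euclideanSpace_fin] at hpd
  refine ⟨fun i => if i ≤ n then p.coeff (n - i) / ballVolume (n - i) else 0,
    fun i hi => if_neg (by omega), fun t ht => ?_⟩
  rw [smul_unitClosedBall_of_nonneg ht, K.isCompact.add_closedBall_zero ht, hp t ht,
    Polynomial.eval_eq_sum_range' (Nat.lt_succ_of_le hpd), ← Finset.sum_range_reflect]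
  refine Finset.sum_congr rfl fun i hi => ?_
  have hi' : i ≤ n := Nat.lt_succ_iff.1 (Finset.mem_range.1 hi)
  simp only [if_pos hi', Nat.succ_sub_one]
  have := (ballVolume_pos (n - i)).ne'
  field_simp

theorem isSteinerSequence_intrinsicVolume {n : ℕ} (K : ConvexBody (EuclideanSpace ℝ (Fin n))) :
    IsSteinerSequence K (intrinsicVolume K) := by
  have h := exists_isSteinerSequence K
  have : intrinsicVolume K = h.choose := by
    funext i
    rw [intrinsicVolume, dif_pos h]
  rw [this]
  exact h.choose_spec

/-! ### Layer cake formula and exponential moments -/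

/-- A layer cake formula for signed weights. -/
theorem integral_integral_Ioi_eq_integral_mul_measureReal {α : Type*} [MeasurableSpace α]
    {μ : Measure α} [SFinite μ] {d : α → ℝ} (hd : Measurable d) (hd0 : ∀ x, 0 ≤ d x)
    (hfin : ∀ t, 0 ≤ t → μ {x | d x ≤ t} ≠ ⊤) {h : ℝ → ℝ} (hh : Measurable h)
    (hInt : IntegrableOn (fun t => h t * μ.real {x | d x ≤ t}) (Set.Ici 0)) :
    Integrable (fun x => ∫ t in Set.Ioi (d x), h t) μ ∧
      ∫ x, (∫ t in Set.Ioi (d x), h t) ∂μ = ∫ t in Set.Ici 0, h t * μ.real {x | d x ≤ t} := by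
  set ν : Measure ℝ := volume.restrict (Set.Ici 0)
  set H : α → ℝ → ℝ := fun x t => {y | d y ≤ t}.indicator (fun _ => h t) x with hH
  have hms : ∀ t, MeasurableSet {y | d y ≤ t} := fun t => measurableSet_le hd measurable_const
  have hHeq : Function.uncurry H =
      {z : α × ℝ | d z.1 ≤ z.2}.indicator (fun z => h z.2) := by
    ext ⟨x, t⟩
    simp [hH, Set.indicator_apply]
  have hHm : Measurable (Function.uncurry H) := by
    rw [hHeq]
    exact (hh.comp measurable_snd).indicator
      (measurableSet_le (hd.comp measurable_fst) measurable_snd)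
  -- The slice at t has L¹ norm |h t| μ{d ≤ t}, the absolute value of the integrand in `hInt`; so
  -- Fubini applies even when h changes sign.
  have hHint : Integrable (Function.uncurry H) (μ.prod ν) := by
    rw [integrable_prod_iff' hHm.aestronglyMeasurable]
    refine ⟨(ae_restrict_iff' measurableSet_Ici).2 (.of_forall fun t ht => ?_), ?_⟩
    · exact (integrable_indicator_iff (hms t)).2 
        (integrableOn_const (C := h t) (hfin t ht))
    · refine hInt.norm.congr (.of_forall fun t => ?_)
      simp only [Function.uncurry, hH, norm_indicator_eq_indicator_norm]
      rw [integral_indicator_const _ (hms t), smul_eq_mul, norm_mul,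
        Real.norm_of_nonneg measureReal_nonneg, mul_comm]
  have hinner : ∀ x, ∫ t, H x t ∂ν = ∫ t in Set.Ioi (d x), h t := by
    intro x
    have : H x = (Set.Ici (d x)).indicator h := by
      ext t
      simp [hH, Set.indicator_apply]
    rw [this, integral_indicator measurableSet_Ici, Measure.restrict_restrict measurableSet_Ici,
      Set.inter_eq_left.2 (Set.Ici_subset_Ici.2 (hd0 x)), integral_Ici_eq_integral_Ioi]
  simp only [← hinner]
  refine ⟨hHint.integral_prod_left, ?_⟩
  rw [integral_integral_swap hHint]
  refine integral_congr_ae (.of_forall fun t => ?_)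
  simp only [hH]
  rw [integral_indicator_const _ (hms t), smul_eq_mul, mul_comm]

theorem integrableOn_pow_mul_exp_neg_mul (j : ℕ) {b : ℝ} (hb : 0 < b) :
    IntegrableOn (fun t : ℝ => t ^ j * Real.exp (-b * t)) (Set.Ici 0) := by
  rw [integrableOn_Ici_iff_integrableOn_Ioi]
  have := integrableOn_rpow_mul_exp_neg_mul_rpow (p := 1) (s := j) (b := b)
    (by linarith [Nat.cast_nonneg (α := ℝ) j]) one_pos hb
  simpa using this

theorem integral_pow_mul_exp_neg_mul (j : ℕ) {b : ℝ} (hb : 0 < b) :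
    ∫ t in Set.Ici (0 : ℝ), t ^ j * Real.exp (-b * t) = j.factorial / b ^ (j + 1) := by
  rw [integral_Ici_eq_integral_Ioi]
  have h := Real.integral_rpow_mul_exp_neg_mul_Ioi (a := (j : ℝ) + 1) (r := b) (by positivity) hb
  rw [Real.Gamma_nat_eq_factorial] at h
  have e : (1 / b) ^ ((j : ℝ) + 1) = (1 / b) ^ (j + 1) := by
    rw [← Nat.cast_succ, Real.rpow_natCast]
  rw [e] at h
  simp only [add_sub_cancel_right, Real.rpow_natCast] at h
  simp only [neg_mul]
  rw [h, one_div, inv_pow]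
  field_simp

theorem integral_Ioi_mul_exp_neg_mul {b : ℝ} (hb : 0 < b) {a : ℝ} (ha : 0 ≤ a) :
    ∫ t in Set.Ioi a, b * Real.exp (-b * t) = Real.exp (-b * a) := by
  have hi := IntegrableOn.mono_set ((integrableOn_pow_mul_exp_neg_mul 0 hb).const_mul b)
    (Set.Ioi_subset_Ici ha)
  simp only [pow_zero, one_mul] at hi
  rw [integral_Ioi_of_hasDerivAt_of_tendsto' (f := fun t => -Real.exp (-b * t)) (m := 0) _ hi]
  · simp
  · have h := Real.tendsto_pow_mul_exp_neg_atTop_nhds_zero 0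
    have h2 := (h.comp (tendsto_id.const_mul_atTop hb)).neg
    simpa [Function.comp_def] using h2
  · intro x _
    refine (((hasDerivAt_id x).const_mul (-b)).exp).neg.congr_deriv ?_
    simp [mul_comm]

/-- The integrand is minus the derivative of b t e^{-bt}. It changes sign at t = 1/b, whence the
signed layer cake formula. -/
theorem integral_Ioi_mul_sub_one_mul_exp_neg_mul {b : ℝ} (hb : 0 < b) {a : ℝ} (ha : 0 ≤ a) :
    ∫ t in Set.Ioi a, b * (b * t - 1) * Real.exp (-b * t) = b * a * Real.exp (-b * a) := by
  have hi := IntegrableOn.mono_set (((integrableOn_pow_mul_exp_neg_mul 1 hb).const_mul (b * b)).sub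
    ((integrableOn_pow_mul_exp_neg_mul 0 hb).const_mul b)) (Set.Ioi_subset_Ici ha)
  have hi' : IntegrableOn (fun t => b * (b * t - 1) * Real.exp (-b * t)) (Set.Ioi a) :=
    hi.congr (.of_forall fun t => by simp only [Pi.sub_apply]; ring)
  rw [integral_Ioi_of_hasDerivAt_of_tendsto' (f := fun t => -(b * t * Real.exp (-b * t)))
    (m := 0) _ hi']
  · simp
  · have h := Real.tendsto_pow_mul_exp_neg_atTop_nhds_zero 1
    have h2 := (h.comp (tendsto_id.const_mul_atTop hb)).neg
    simpa [Function.comp_def] using h2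
  · intro x _
    have h1 := (hasDerivAt_id x).const_mul b
    have h2 := ((hasDerivAt_id x).const_mul (-b)).exp
    refine (h1.mul h2).neg.congr_deriv ?_
    simp only [id]
    ring

/-! ### Ball constants -/

theorem ballVolume_eq (m : ℕ) : ballVolume m = √Real.pi ^ m / Real.Gamma (m / 2 + 1) := by
  rcases Nat.eq_zero_or_pos m with rfl | hm
  · simp [ballVolume, measureReal_def, volume_euclideanSpace_eq_dirac]
  · have : Nonempty (Fin m) := ⟨⟨0, hm⟩⟩
    have hG : 0 < Real.Gamma ((m : ℝ) / 2 + 1) := Real.Gamma_pos_of_pos (by positivity)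
    rw [ballVolume, measureReal_def, EuclideanSpace.volume_closedBall]
    simp only [Fintype.card_fin, ENNReal.ofReal_one, one_pow, one_mul]
    exact ENNReal.toReal_ofReal (by positivity)

/-- Legendre's duplication formula at j/2 + 1. This is where the rate 2π in the exponential comes
from. -/
theorem sphereArea_succ_mul_ballVolume (j : ℕ) :
    sphereArea (j + 1) * ballVolume j * j.factorial = 2 * (2 * Real.pi) ^ j := by
  have hG1 : 0 < Real.Gamma ((j : ℝ) / 2 + 1) := Real.Gamma_pos_of_pos (by positivity)
  have hG2 : 0 < Real.Gamma ((j : ℝ) / 2 + 1 + 1 / 2) := Real.Gamma_pos_of_pos (by positivity)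
  have hdup := Real.Gamma_mul_Gamma_add_half ((j : ℝ) / 2 + 1)
  have e1 : Real.Gamma (2 * ((j : ℝ) / 2 + 1)) = (j + 1).factorial := by
    rw [← Real.Gamma_nat_eq_factorial]; congr 1; push_cast; ring
  have e2 : (2 : ℝ) ^ (1 - 2 * ((j : ℝ) / 2 + 1)) = (2 ^ (j + 1))⁻¹ := by
    rw [show 1 - 2 * ((j : ℝ) / 2 + 1) = -((j + 1 : ℕ) : ℝ) by push_cast; ring,
      Real.rpow_neg zero_le_two, Real.rpow_natCast]
  rw [e1, e2] at hdup
  have e3 : (((j + 1 : ℕ) : ℝ) / 2 + 1) = (j : ℝ) / 2 + 1 + 1 / 2 := by push_cast; ring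
  have hs : √Real.pi * √Real.pi = Real.pi := Real.mul_self_sqrt Real.pi_pos.le
  have hs0 : 0 < √Real.pi := Real.sqrt_pos.2 Real.pi_pos
  have hf : (0 : ℝ) < (j + 1).factorial := by positivity
  rw [sphereArea, ballVolume_eq, ballVolume_eq, e3]
  calc ((j + 1 : ℕ) : ℝ) * (√Real.pi ^ (j + 1) / Real.Gamma ((j : ℝ) / 2 + 1 + 1 / 2)) *
        (√Real.pi ^ j / Real.Gamma ((j : ℝ) / 2 + 1)) * j.factorial
      = (((j + 1 : ℕ) : ℝ) * j.factorial) * (√Real.pi * √Real.pi) ^ j * √Real.pi /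
        (Real.Gamma ((j : ℝ) / 2 + 1) * Real.Gamma ((j : ℝ) / 2 + 1 + 1 / 2)) := by
        field_simp
        ring
    _ = 2 * (2 * Real.pi) ^ j := by
        rw [hdup, hs, ← Nat.cast_mul, ← Nat.factorial_succ]
        field_simp
        ring

/-! ### Rotation volumes as integrals -/

section RotationVolumes

variable {n : ℕ} (K : ConvexBody (EuclideanSpace ℝ (Fin n)))

theorem setOf_infDist_le_eq_add_smul_closedBall {t : ℝ} (ht : 0 ≤ t) :
    {x | infDist x (K : Set (EuclideanSpace ℝ (Fin n))) ≤ t} =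
      (K : Set (EuclideanSpace ℝ (Fin n))) +
        t • closedBall (0 : EuclideanSpace ℝ (Fin n)) 1 := by
  rw [smul_unitClosedBall_of_nonneg ht, K.isCompact.add_closedBall_zero ht]
  ext x
  rw [Set.mem_ofPred_eq, mem_cthickening_iff, infDist,
    ENNReal.le_ofReal_iff_toReal_le (infEDist_ne_top K.nonempty) ht]

/-- Steiner's formula for the sublevel sets of the distance function. -/
theorem measureReal_setOf_infDist_le {t : ℝ} (ht : 0 ≤ t) :
    volume.real {x | infDist x (K : Set (EuclideanSpace ℝ (Fin n))) ≤ t} =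
      ∑ j ∈ Finset.range (n + 1), ballVolume j * intrinsicVolume K (n - j) * t ^ j := by
  rw [setOf_infDist_le_eq_add_smul_closedBall K ht,
    (isSteinerSequence_intrinsicVolume K).2 t ht, ← Finset.sum_range_reflect]
  refine Finset.sum_congr rfl fun j hj => ?_
  have hj' := Finset.mem_range.1 hj
  rw [show n + 1 - 1 - j = n - j by omega, show n - (n - j) = j by omega]
  ring

theorem measure_setOf_infDist_le_ne_top {t : ℝ} (ht : 0 ≤ t) :
    volume {x | infDist x (K : Set (EuclideanSpace ℝ (Fin n))) ≤ t} ≠ ⊤ := by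
  rw [setOf_infDist_le_eq_add_smul_closedBall K ht]
  exact (K.isCompact.add ((isCompact_closedBall _ _).smul t)).measure_lt_top.ne

/-- Steiner's formula integrated against the derivative of a weight. -/
theorem integral_integral_Ioi_infDist {h : ℝ → ℝ} (hh : Measurable h)
    (hInt : ∀ j : ℕ, IntegrableOn (fun t => t ^ j * h t) (Set.Ici 0)) :
    Integrable (fun x => ∫ t in Set.Ioi (infDist x (K : Set (EuclideanSpace ℝ (Fin n)))), h t) ∧
      ∫ x, (∫ t in Set.Ioi (infDist x (K : Set (EuclideanSpace ℝ (Fin n)))), h t) =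
        ∑ j ∈ Finset.range (n + 1), ballVolume j * intrinsicVolume K (n - j) *
          ∫ t in Set.Ici 0, t ^ j * h t := by
  have hterm : ∀ j ∈ Finset.range (n + 1), IntegrableOn
      (fun t => ballVolume j * intrinsicVolume K (n - j) * (t ^ j * h t)) (Set.Ici 0) :=
    fun j _ => (hInt j).const_mul _
  have heq : Set.EqOn
      (fun t => h t * volume.real {x | infDist x (K : Set (EuclideanSpace ℝ (Fin n))) ≤ t})
      (fun t => ∑ j ∈ Finset.range (n + 1),
        ballVolume j * intrinsicVolume K (n - j) * (t ^ j * h t)) (Set.Ici 0) := by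
    intro t ht
    simp only [measureReal_setOf_infDist_le K ht, Finset.mul_sum]
    exact Finset.sum_congr rfl fun j _ => by ring
  obtain ⟨h1, h2⟩ := integral_integral_Ioi_eq_integral_mul_measureReal
    (continuous_infDist_pt (K : Set (EuclideanSpace ℝ (Fin n)))).measurable
    (fun x => infDist_nonneg) (fun t ht => measure_setOf_infDist_le_ne_top K ht) hh
    ((integrableOn_congr_fun heq measurableSet_Ici).2 (integrable_finsetSum _ hterm))
  refine ⟨h1, h2.trans ?_⟩
  rw [setIntegral_congr_fun measurableSet_Ici heq, integral_finsetSum _ hterm]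
  exact Finset.sum_congr rfl fun j _ => integral_const_mul _ _

theorem integral_exp_neg_mul_infDist {b : ℝ} (hb : 0 < b) :
    Integrable (fun x => Real.exp (-b * infDist x (K : Set (EuclideanSpace ℝ (Fin n))))) ∧
      ∫ x, Real.exp (-b * infDist x (K : Set (EuclideanSpace ℝ (Fin n)))) =
        ∑ j ∈ Finset.range (n + 1), ballVolume j * intrinsicVolume K (n - j) *
          (j.factorial / b ^ j) := by
  have hfun : ∀ j : ℕ, (fun t : ℝ => t ^ j * (b * Real.exp (-b * t))) =
      fun t => b * (t ^ j * Real.exp (-b * t)) := fun j => by ext t; ring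
  have h := integral_integral_Ioi_infDist K (h := fun t => b * Real.exp (-b * t))
    (by fun_prop) fun j => by
      rw [hfun]
      exact (integrableOn_pow_mul_exp_neg_mul j hb).const_mul b
  simp only [integral_Ioi_mul_exp_neg_mul hb infDist_nonneg, hfun, integral_const_mul,
    integral_pow_mul_exp_neg_mul _ hb] at h
  refine ⟨h.1, h.2.trans (Finset.sum_congr rfl fun j _ => ?_)⟩
  field_simp
  ring

/-- The j-th moment of the weight is ((j+1)! - j!)/b^j = j·j!/b^j, which supplies the factor j of an
expected index. -/
theorem integral_mul_infDist_mul_exp_neg_mul_infDist {b : ℝ} (hb : 0 < b) :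
    Integrable (fun x => b * infDist x (K : Set (EuclideanSpace ℝ (Fin n))) *
        Real.exp (-b * infDist x (K : Set (EuclideanSpace ℝ (Fin n))))) ∧
      ∫ x, b * infDist x (K : Set (EuclideanSpace ℝ (Fin n))) *
          Real.exp (-b * infDist x (K : Set (EuclideanSpace ℝ (Fin n)))) =
        ∑ j ∈ Finset.range (n + 1), ballVolume j * intrinsicVolume K (n - j) *
          (j * (j.factorial / b ^ j)) := by
  have hfun : ∀ j : ℕ, (fun t : ℝ => t ^ j * (b * (b * t - 1) * Real.exp (-b * t))) =
      fun t => b * b * (t ^ (j + 1) * Real.exp (-b * t)) - b * (t ^ j * Real.exp (-b * t)) :=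
    fun j => by ext t; ring
  have hInt : ∀ (j : ℕ) (c : ℝ),
      IntegrableOn (fun t : ℝ => c * (t ^ j * Real.exp (-b * t))) (Set.Ici 0) :=
    fun j c => (integrableOn_pow_mul_exp_neg_mul j hb).const_mul c
  have h := integral_integral_Ioi_infDist K (h := fun t => b * (b * t - 1) * Real.exp (-b * t))
    (by fun_prop) fun j => by
      rw [hfun]
      exact (hInt _ _).sub (hInt _ _)
  simp only [integral_Ioi_mul_sub_one_mul_exp_neg_mul hb infDist_nonneg, hfun] at h
  refine ⟨h.1, h.2.trans (Finset.sum_congr rfl fun j _ => ?_)⟩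
  rw [integral_sub (hInt _ _) (hInt _ _), integral_const_mul, integral_const_mul,
    integral_pow_mul_exp_neg_mul _ hb, integral_pow_mul_exp_neg_mul _ hb, Nat.factorial_succ]
  congr 1
  push_cast
  field_simp
  ring

theorem sphereArea_succ_pos (m : ℕ) : 0 < sphereArea (m + 1) :=
  mul_pos (by positivity) (ballVolume_pos _)

theorem rotationVolume_eq (j : ℕ) :
    rotationVolume K j = sphereArea (n + 1) / 2 *
      (ballVolume j * intrinsicVolume K (n - j) * (j.factorial / (2 * Real.pi) ^ j)) := by
  have h := sphereArea_succ_mul_ballVolume j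
  have hs := (sphereArea_succ_pos j).ne'
  have hpi : (0 : ℝ) < (2 * Real.pi) ^ j := by positivity
  rw [rotationVolume, div_mul_eq_mul_div, div_eq_iff hs]
  calc sphereArea (n + 1) * intrinsicVolume K (n - j)
      = sphereArea (n + 1) / 2 * intrinsicVolume K (n - j) / (2 * Real.pi) ^ j *
          (2 * (2 * Real.pi) ^ j) := by field_simp
    _ = _ := by rw [← h]; ring

theorem totalRotationVolume_eq_integral :
    totalRotationVolume K = sphereArea (n + 1) / 2 *
      ∫ x, Real.exp (-(2 * Real.pi) * infDist x (K : Set (EuclideanSpace ℝ (Fin n)))) := by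
  rw [(integral_exp_neg_mul_infDist K Real.two_pi_pos).2, Finset.mul_sum, totalRotationVolume]
  exact Finset.sum_congr rfl fun j _ => rotationVolume_eq K j

/-- Positivity is read off the integral, so no sign of the individual intrinsic volumes is needed.
-/
theorem totalRotationVolume_pos : 0 < totalRotationVolume K := by
  rw [totalRotationVolume_eq_integral]
  exact mul_pos (half_pos (sphereArea_succ_pos n))
    (integral_exp_pos (integral_exp_neg_mul_infDist K Real.two_pi_pos).1)

/-- The probabilities sum to one, so n minus the mean of n - i is the mean of i. -/
theorem sub_centralRotationVolume_eq :
    (n : ℝ) - centralRotationVolume K =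
      (∑ j ∈ Finset.range (n + 1), j * rotationVolume K j) / totalRotationVolume K := by
  have hW := (totalRotationVolume_pos K).ne'
  have h1 : centralRotationVolume K = (n * totalRotationVolume K -
      ∑ j ∈ Finset.range (n + 1), j * rotationVolume K j) / totalRotationVolume K := by
    rw [centralRotationVolume]
    conv_rhs => enter [1, 1, 2]; rw [totalRotationVolume]
    rw [Finset.mul_sum, ← Finset.sum_sub_distrib, Finset.sum_div]
    exact Finset.sum_congr rfl fun j _ => by ring
  rw [h1]
  field_simp
  ring

end RotationVolumes

theorem proposition3p3 {n : ℕ} (K : ConvexBody (EuclideanSpace ℝ (Fin n))) :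
    (MeasureTheory.Integrable (fun x : EuclideanSpace ℝ (Fin n) =>
        Real.exp (-2 * Real.pi * Metric.infDist x (K : Set (EuclideanSpace ℝ (Fin n)))))
        MeasureTheory.volume ∧
      totalRotationVolume K = sphereArea (n + 1) / 2 *
        ∫ x : EuclideanSpace ℝ (Fin n),
          Real.exp (-2 * Real.pi * Metric.infDist x (K : Set (EuclideanSpace ℝ (Fin n))))) ∧
    (MeasureTheory.Integrable (fun x : EuclideanSpace ℝ (Fin n) =>
        2 * Real.pi * Metric.infDist x (K : Set (EuclideanSpace ℝ (Fin n))) *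
          Real.exp (-2 * Real.pi * Metric.infDist x (K : Set (EuclideanSpace ℝ (Fin n)))))
        MeasureTheory.volume ∧
      (n : ℝ) - centralRotationVolume K = sphereArea (n + 1) / (2 * totalRotationVolume K) *
        ∫ x : EuclideanSpace ℝ (Fin n),
          2 * Real.pi * Metric.infDist x (K : Set (EuclideanSpace ℝ (Fin n))) *
            Real.exp (-2 * Real.pi *
              Metric.infDist x (K : Set (EuclideanSpace ℝ (Fin n))))) := by
  have e : (-2 * Real.pi : ℝ) = -(2 * Real.pi) := by ring
  simp only [e]
  have h1 := integral_exp_neg_mul_infDist K Real.two_pi_pos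
  have h2 := integral_mul_infDist_mul_exp_neg_mul_infDist K Real.two_pi_pos
  refine ⟨⟨h1.1, totalRotationVolume_eq_integral K⟩, h2.1, ?_⟩
  have hW := (totalRotationVolume_pos K).ne'
  have hsum : ∑ j ∈ Finset.range (n + 1), j * rotationVolume K j =
      sphereArea (n + 1) / 2 * ∑ j ∈ Finset.range (n + 1),
        ballVolume j * intrinsicVolume K (n - j) *
          (j * (j.factorial / (2 * Real.pi) ^ j)) := by
    rw [Finset.mul_sum]
    exact Finset.sum_congr rfl fun j _ => by rw [rotationVolume_eq]; ring
  rw [sub_centralRotationVolume_eq, h2.2, hsum]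
  field_simp
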